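/- Let $\mathbf E\subset\mathbb R^d$ be a convex compact set and let $\mathbf A$ be a family of compact subsets of $\mathbf E$ that is closed under arbitrary (nonempty) intersections and satisfies $\varnothing,\mathbf E\in\mathbf A$. Equip $\mathbf A$ with the $\sigma$-algebra $\mathcal A=\sigma([B]: B\in\mathbf A)$, where $[B]=\{A\in\mathbf A: A\subseteq B\}$. Let $M(\mathbf E)$ be the space of measures on the Borel sets of $\mathbf E$ with values in $\{0,1,2,\dots\}$, with the $\sigma$-algebra generated by the maps $\nu\mapsto\nu(B)$, $B\subseteq\mathbf E$ Borel. Fix a known intensity $\lambda>0$. For $A\in\mathbf A$ let $\mathbb P_A$ be the law on $M(\mathbf E)$ of a Poisson point process $\mathcal N$ of intensity $\lambda$ on $A$, i.e. $\mathcal N(B)\sim\mathrm{Poiss}(\lambda|A\cap B|)$ for every Borel set $B\subseteq\mathbf E$, where $|\cdot|$ is Lebesgue measure, and $\mathcal N(B_1),\dots,\mathcal N(B_n)$ are independent for all mutually disjoint Borel sets $B_1,\dots,B_n\subseteq\mathbf E$. Let $$\hat A=\bigcap\{A\in\mathbf A:\ X_i\in A \text{ for } i=1,\dots,N\}\in\mathbf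 A$$ be the wrapping hull of the points $X_1,\dots,X_N$ of $\mathcal N$. **Theorem.** The map $\hat A: M(\mathbf E)\to(\mathbf A,\mathcal A)$ is measurable, and it is a sufficient and complete statistic for the model $(\mathbb P_A)_{A\in\mathbf A}$. That is: 1. (Sufficiency) for every event $F$ in $M(\mathbf E)$ there is an $\mathcal A$-measurable function $g_F:\mathbf A\to\mathbb R$, not depending on $A$, such that $\mathbb P_A(F\mid \hat A)=g_F(\hat A)$ holds $\mathbb P_A$-almost surely for every $A\in\mathbf A$; 2. (Completeness) if $T:\mathbf A\to\mathbb R$ is $\mathcal A$-measurable, $T(\hat A)$ is $\mathbb P_A$-integrable and $\mathbb E_A[T(\hat A)]=0$ for every $A\in\mathbf A$, then $T(\hat A)=0$ holds $\mathbb P_A$-almost surely for every $A\in\mathbf A$ (in particular for $A=\mathbf E$). -/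

import Mathlib

open MeasureTheory ProbabilityTheory
open scoped NNReal ENNReal

noncomputable section

namespace WrappingHull

/-- A class `𝒜` of compact subsets of the observation window `E ⊆ ℝ^d` which contains `∅` and `E`
and is closed under arbitrary (nonempty) intersections. -/
structure SetClass {d : ℕ} (E : Set (EuclideanSpace ℝ (Fin d))) where
  /-- The members of the class. -/
  sets : Set (Set (EuclideanSpace ℝ (Fin d)))
  isCompact_of_mem : ∀ A ∈ sets, IsCompact A
  subset_of_mem : ∀ A ∈ sets, A ⊆ E
  sInter_mem : ∀ S : Set (Set (EuclideanSpace ℝ (Fin d))), S ⊆ sets → S.Nonempty → ⋂₀ S ∈ sets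
  empty_mem : ∅ ∈ sets
  window_mem : E ∈ sets

/-- The type of members of the class `𝒜`. -/
@[ext]
structure SetClass.Elem {d : ℕ} {E : Set (EuclideanSpace ℝ (Fin d))} (𝒜 : SetClass E) where
  /-- The member as a set. -/
  carrier : Set (EuclideanSpace ℝ (Fin d))
  mem : carrier ∈ 𝒜.sets

/-- The bracket `[B] = {A ∈ 𝒜 : A ⊆ B}` of a member `B` of the class. -/
def SetClass.bracket {d : ℕ} {E : Set (EuclideanSpace ℝ (Fin d))} (𝒜 : SetClass E)
    (B : 𝒜.Elem) : Set 𝒜.Elem :=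
  {A | A.carrier ⊆ B.carrier}

/-- The σ-algebra `σ([B], B ∈ 𝒜)` on the class `𝒜`. -/
instance SetClass.instMeasurableSpaceElem {d : ℕ} {E : Set (EuclideanSpace ℝ (Fin d))}
    (𝒜 : SetClass E) : MeasurableSpace 𝒜.Elem :=
  MeasurableSpace.generateFrom (Set.range 𝒜.bracket)

/-- The space `M(E)` of point configurations on `E`: Borel measures on `ℝ^d` which are concentrated
on `E` and take values in `{0, 1, 2, …}`. Its σ-algebra (inherited from that of `Measure`) is
generated by the evaluations `ν ↦ ν B`, `B` a Borel set. -/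
abbrev PointConfig {d : ℕ} (E : Set (EuclideanSpace ℝ (Fin d))) : Type :=
  {ν : Measure (EuclideanSpace ℝ (Fin d)) //
    ν Eᶜ = 0 ∧ ∀ B, MeasurableSet B → ∃ n : ℕ, ν B = (n : ℝ≥0∞)}

/-- The set `{X_1, …, X_N}` of points of a configuration `ν`, that is, the set of its atoms. -/
def PointConfig.points {d : ℕ} {E : Set (EuclideanSpace ℝ (Fin d))} (ν : PointConfig E) :
    Set (EuclideanSpace ℝ (Fin d)) :=
  {x | ν.1 {x} ≠ 0}

/-- Under the probability measure `μ`, the random configuration `N : Ω → M(E)` is a Poisson point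
process of intensity `lam` on the set `A ⊆ E`: `N` is measurable, `N(B)` is Poisson distributed
with parameter `lam * |A ∩ B|` for every Borel set `B ⊆ E`, and `N(B_1), …, N(B_n)` are independent
for all mutually disjoint Borel sets `B_1, …, B_n ⊆ E`. -/
structure IsPoissonPointProcess {d : ℕ} {E : Set (EuclideanSpace ℝ (Fin d))} {Ω : Type*}
    [MeasurableSpace Ω] (lam : ℝ≥0) (A : Set (EuclideanSpace ℝ (Fin d))) (N : Ω → PointConfig E)
    (μ : Measure Ω) : Prop where
  measurable : Measurable N
  hasLaw_poisson : ∀ B, MeasurableSet B → B ⊆ E →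
    HasLaw (fun ω => (N ω).1 B)
      ((poissonMeasure (lam * (volume (A ∩ B)).toNNReal)).map (fun n : ℕ => (n : ℝ≥0∞))) μ
  iIndepFun : ∀ (n : ℕ) (B : Fin n → Set (EuclideanSpace ℝ (Fin d))),
    (∀ i, MeasurableSet (B i)) → (∀ i, B i ⊆ E) → Pairwise (fun i j => Disjoint (B i) (B j)) →
    ProbabilityTheory.iIndepFun (fun i ω => (N ω).1 (B i)) μ

/-- The intersection of all members of `𝒜` which contain the set `S`. -/
def SetClass.wrap {d : ℕ} {E : Set (EuclideanSpace ℝ (Fin d))} (𝒜 : SetClass E)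
    (S : Set (EuclideanSpace ℝ (Fin d))) : Set (EuclideanSpace ℝ (Fin d)) :=
  ⋂₀ {A | A ∈ 𝒜.sets ∧ S ⊆ A}

theorem PointConfig.points_subset {d : ℕ} {E : Set (EuclideanSpace ℝ (Fin d))}
    (ν : PointConfig E) : ν.points ⊆ E := by
  intro x hx
  by_contra hxE
  exact hx (measure_mono_null (Set.singleton_subset_iff.2 hxE) ν.2.1)

theorem SetClass.wrap_mem {d : ℕ} {E : Set (EuclideanSpace ℝ (Fin d))} (𝒜 : SetClass E)
    {S : Set (EuclideanSpace ℝ (Fin d))} (hS : S ⊆ E) : 𝒜.wrap S ∈ 𝒜.sets :=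
  𝒜.sInter_mem _ (fun _ hA => hA.1) ⟨E, 𝒜.window_mem, hS⟩

/-- The `𝒜`-wrapping hull `Â = ⋂ {A ∈ 𝒜 : X_i ∈ A for all i}`, a mapping `M(E) → 𝒜`. -/
def SetClass.wrappingHull {d : ℕ} {E : Set (EuclideanSpace ℝ (Fin d))} (𝒜 : SetClass E)
    (ν : PointConfig E) : 𝒜.Elem :=
  ⟨𝒜.wrap ν.points, 𝒜.wrap_mem ν.points_subset⟩

/-- The statistic `S` is sufficient for the statistical model `(P θ)_θ`: for every event `F` there
is a version of the conditional probability `P θ (F | S)` which does not depend on `θ`. -/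
def IsSufficient {Θ X T : Type*} [MeasurableSpace X] [mT : MeasurableSpace T]
    (P : Θ → Measure X) (S : X → T) : Prop :=
  Measurable S ∧
    ∀ F : Set X, MeasurableSet F → ∃ g : T → ℝ, Measurable g ∧
      ∀ θ, (P θ)[F.indicator (fun _ => (1 : ℝ)) | MeasurableSpace.comap S mT]
        =ᵐ[P θ] fun x => g (S x)

/-- The statistic `S` is complete for the statistical model `(P θ)_θ`: if `h` is a real measurable
function with `𝔼_θ[h(S)] = 0` for all `θ`, then `h(S) = 0` holds `P θ`-almost surely for
all `θ`. -/
def IsComplete {Θ X T : Type*} [MeasurableSpace X] [MeasurableSpace T]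
    (P : Θ → Measure X) (S : X → T) : Prop :=
  Measurable S ∧
    ∀ h : T → ℝ, Measurable h → (∀ θ, Integrable (fun x => h (S x)) (P θ)) →
      (∀ θ, ∫ x, h (S x) ∂(P θ) = 0) → ∀ θ, ∀ᵐ x ∂(P θ), h (S x) = 0

end WrappingHull

end

/-! A Poisson process on `E`, conditioned to have no points in `E \ A`, is a Poisson process on `A`
(`IsPoissonPointProcess.map_restrict`), and a configuration has no points in `E \ A` exactly when
its hull lies in `[A]` (`SetClass.wrappingHull_preimage_bracket`). So with `Q` the law for `E`, the
law for `A` is `Q` restricted to `{Â ∈ [A]}`, divided by the positive void probability. Its density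
with respect to `Q` is thus a function of `Â`, which gives sufficiency. For completeness, `𝔼_A[T(Â)]
= 0` says that `T` integrates to zero over `[A]` under the `Q`-law of `Â`. The brackets form a
generating π-system containing the whole class, so `T` vanishes almost everywhere. -/

namespace WrappingHull

/-! ### Sufficiency and completeness for restrictions of one dominating measure -/

section Abstract

variable {Θ X T : Type*} [MeasurableSpace X] [mT : MeasurableSpace T]

/-- A statistic `S` is sufficient if each law of the model is proportional to the restriction of a
fixed finite measure to an event described by `S`. -/
theorem isSufficient_of_eq_smul_restrict {P : Θ → Measure X} {S : X → T} (hS : Measurable S)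
    (Q : Measure X) [IsFiniteMeasure Q] (c : Θ → ℝ≥0∞) (hc : ∀ θ, c θ ≠ ∞) (C : Θ → Set T)
    (hC : ∀ θ, MeasurableSet (C θ)) (hP : ∀ θ, P θ = c θ • Q.restrict (S ⁻¹' C θ)) :
    IsSufficient P S := by
  refine ⟨hS, fun F hF => ?_⟩
  have hm : MeasurableSpace.comap S mT ≤ ‹MeasurableSpace X› := hS.comap_le
  set f : X → ℝ := F.indicator fun _ => (1 : ℝ) with hf
  have hfint : Integrable f Q := (integrable_const (1 : ℝ)).indicator hF
  -- Doob–Dynkin: the conditional expectation under `Q` factors through `S`, and this one `g` serves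
  -- every `θ`.
  obtain ⟨g, hg, hgeq⟩ : ∃ g : T → ℝ, Measurable g ∧
      Q[f | MeasurableSpace.comap S mT] = g ∘ S :=
    (stronglyMeasurable_condExp (μ := Q) (f := f)
      (m := MeasurableSpace.comap S mT)).measurable.exists_eq_measurable_comp
  refine ⟨g, hg, fun θ => ?_⟩
  have hgint : Integrable (fun x => g (S x)) Q := by
    change Integrable (g ∘ S) Q
    rw [← hgeq]
    exact integrable_condExp
  have hfin : IsFiniteMeasure (P θ) := by
    rw [hP θ]
    exact Measure.smul_finite _ (hc θ)
  refine (ae_eq_condExp_of_forall_setIntegral_eq hm ?_ ?_ ?_ ?_).symm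
  · rw [hP θ]
    exact (hfint.restrict).smul_measure (hc θ)
  · intro s _ _
    rw [hP θ]
    exact ((hgint.restrict).smul_measure (hc θ)).integrableOn
  · intro s hs _
    have hs' := hm s hs
    -- Integrating over `s` under `P θ` is, up to `c θ`, integrating over this set under `Q`. It is
    -- still an event of `S`, so the averaging property carries over.
    have hsC : MeasurableSet[MeasurableSpace.comap S mT] (s ∩ S ⁻¹' C θ) :=
      MeasurableSet.inter hs ⟨C θ, hC θ, rfl⟩
    rw [hP θ, Measure.restrict_smul, integral_smul_measure, integral_smul_measure,
      Measure.restrict_restrict hs']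
    congr 1
    rw [← setIntegral_condExp hm hfint hsC, hgeq]
    rfl
  · exact ((hg.comp (comap_measurable S)).stronglyMeasurable).aestronglyMeasurable

/-- A statistic `S` is complete if each law of the model is proportional to the restriction of a
fixed measure to an event `{S ∈ C θ}`, where the sets `C θ` form a generating
`π`-system. -/
theorem isComplete_of_eq_smul_restrict {P : Θ → Measure X} {S : X → T} (hS : Measurable S)
    (Q : Measure X) (c : Θ → ℝ≥0∞) (hc : ∀ θ, c θ ≠ ∞) (hc0 : ∀ θ, c θ ≠ 0)
    (C : Θ → Set T) (hgen : mT = MeasurableSpace.generateFrom (Set.range C))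
    (hpi : IsPiSystem (Set.range C)) (θ₀ : Θ) (hθ₀ : C θ₀ = Set.univ)
    (hP : ∀ θ, P θ = c θ • Q.restrict (S ⁻¹' C θ)) :
    IsComplete P S := by
  refine ⟨hS, fun h hh hint hzero => ?_⟩
  have hC : ∀ θ, MeasurableSet (C θ) := fun θ => by
    rw [hgen]
    exact MeasurableSpace.measurableSet_generateFrom ⟨θ, rfl⟩
  set ρ : Measure T := Q.map S with hρ
  have hsub : ∀ θ, ∫ t in C θ, h t ∂ρ = 0 := by
    intro θ
    rw [hρ, setIntegral_map (hC θ) hh.aestronglyMeasurable hS.aemeasurable]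
    have := hzero θ
    rw [hP θ, integral_smul_measure, smul_eq_zero] at this
    refine this.resolve_left ?_
    exact ENNReal.toReal_ne_zero.2 ⟨hc0 θ, hc θ⟩
  have hintρ : Integrable h ρ := by
    have := hint θ₀
    rw [hP θ₀, hθ₀, Set.preimage_univ, Measure.restrict_univ,
      integrable_smul_measure (hc0 θ₀) (hc θ₀)] at this
    exact (integrable_map_measure hh.aestronglyMeasurable hS.aemeasurable).2 this
  -- The complement step of the π-λ induction needs a zero total integral, hence the parameter `θ₀`.
  have huniv : ∫ t, h t ∂ρ = 0 := by simpa [hθ₀] using hsub θ₀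
  have hall : ∀ s, MeasurableSet s → ∫ t in s, h t ∂ρ = 0 := by
    intro s hs
    induction s, hs using MeasurableSpace.induction_on_inter hgen hpi with
    | empty => simp
    | basic s hs =>
      obtain ⟨θ, rfl⟩ := hs
      exact hsub θ
    | compl s hs ih => rw [setIntegral_compl hs hintρ, ih, huniv, sub_zero]
    | iUnion f hd hf ih =>
      rw [integral_iUnion hf hd hintρ.integrableOn]
      simp [ih]
  have hzeroρ : h =ᵐ[ρ] 0 :=
    hintρ.ae_eq_zero_of_forall_setIntegral_eq_zero fun s hs _ => hall s hs
  have hzeroQ : ∀ᵐ x ∂Q, h (S x) = 0 := ae_of_ae_map hS.aemeasurable hzeroρ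
  intro θ
  rw [hP θ]
  exact Measure.ae_smul_measure (ae_restrict_of_ae hzeroQ) _

end Abstract

/-! ### Atoms of configurations and events of the hull -/

section Points

variable {d : ℕ} {E : Set (EuclideanSpace ℝ (Fin d))}

theorem PointConfig.measurable_apply {B : Set (EuclideanSpace ℝ (Fin d))} (hB : MeasurableSet B) :
    Measurable fun ν : PointConfig E => ν.1 B :=
  (Measure.measurable_coe hB).comp measurable_subtype_coe

theorem PointConfig.isFiniteMeasure (ν : PointConfig E) : IsFiniteMeasure ν.1 := by
  obtain ⟨n, hn⟩ := ν.2.2 Set.univ MeasurableSet.univ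
  exact ⟨by simp [hn]⟩

/-- A set of positive mass contains a point of the configuration. -/
theorem PointConfig.exists_mem_points (ν : PointConfig E) {C : Set (EuclideanSpace ℝ (Fin d))}
    (hC : MeasurableSet C) (h : ν.1 C ≠ 0) : ∃ x ∈ C, x ∈ ν.points := by
  have := ν.isFiniteMeasure
  obtain ⟨x, hxC, hx⟩ := exists_mem_forall_mem_nhdsWithin_pos_measure h
  refine ⟨x, hxC, ?_⟩
  -- Masses are integers, so positive means at least `1`; this bound survives shrinking the balls to
  -- `{x}`, making `x` an atom.
  have hone : ∀ n : ℕ, 1 ≤ ν.1 (Metric.closedBall x (1 / (n + 1 : ℝ)) ∩ C) := by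
    intro n
    have hpos : 0 < ν.1 (Metric.closedBall x (1 / (n + 1 : ℝ)) ∩ C) :=
      hx _ (Filter.inter_mem
        (mem_nhdsWithin_of_mem_nhds (Metric.closedBall_mem_nhds _ Nat.one_div_pos_of_nat))
        self_mem_nhdsWithin)
    obtain ⟨k, hk⟩ := ν.2.2 _ (Metric.isClosed_closedBall.measurableSet.inter hC)
    rw [hk] at hpos ⊢
    exact_mod_cast hpos
  have hanti : Antitone fun n : ℕ => Metric.closedBall x (1 / (n + 1 : ℝ)) ∩ C :=
    fun m n hmn => Set.inter_subset_inter_left _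
      (Metric.closedBall_subset_closedBall (Nat.one_div_le_one_div hmn))
  have hlim := tendsto_measure_iInter_atTop (μ := ν.1)
    (fun n : ℕ => (Metric.isClosed_closedBall.measurableSet.inter hC).nullMeasurableSet)
    hanti ⟨0, measure_ne_top _ _⟩
  have hinter : ⋂ n : ℕ, Metric.closedBall x (1 / (n + 1 : ℝ)) ∩ C ⊆ {x} := by
    intro y hy
    rw [Set.mem_iInter] at hy
    have : dist y x ≤ 0 := ge_of_tendsto' tendsto_one_div_add_atTop_nhds_zero_nat
      fun n => Metric.mem_closedBall.1 (hy n).1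
    exact dist_le_zero.1 this
  have hge := (ge_of_tendsto' hlim hone).trans (measure_mono hinter)
  exact (zero_lt_one.trans_le hge).ne'

/-- Integrality is what makes this true: any mass outside `B` must include an atom there. It
replaces a condition on atoms by one on a single count. -/
theorem PointConfig.points_subset_iff (ν : PointConfig E) {B : Set (EuclideanSpace ℝ (Fin d))}
    (hB : MeasurableSet B) : ν.points ⊆ B ↔ ν.1 Bᶜ = 0 := by
  constructor
  · intro h
    by_contra hne
    obtain ⟨x, hx, hxp⟩ := ν.exists_mem_points hB.compl hne
    exact hx (h hxp)
  · intro h x hx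
    by_contra hxB
    exact hx (measure_mono_null (Set.singleton_subset_iff.2 hxB) h)

theorem SetClass.Elem.measurableSet {𝒜 : SetClass E} (A : 𝒜.Elem) : MeasurableSet A.carrier :=
  (𝒜.isCompact_of_mem _ A.mem).measurableSet

theorem SetClass.wrappingHull_mem_bracket {𝒜 : SetClass E} {ν : PointConfig E} {B : 𝒜.Elem} :
    𝒜.wrappingHull ν ∈ 𝒜.bracket B ↔ ν.points ⊆ B.carrier :=
  ⟨fun h => (Set.subset_sInter fun _ hA => hA.2).trans h,
    fun h => Set.sInter_subset_of_mem ⟨B.mem, h⟩⟩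

theorem SetClass.wrappingHull_preimage_bracket {𝒜 : SetClass E} (B : 𝒜.Elem) :
    𝒜.wrappingHull ⁻¹' 𝒜.bracket B = {ν : PointConfig E | ν.1 (E \ B.carrier) = 0} := by
  ext ν
  have hsub : B.carrierᶜ ⊆ (E \ B.carrier) ∪ Eᶜ := fun x hx => by
    by_cases hxE : x ∈ E
    · exact Or.inl ⟨hxE, hx⟩
    · exact Or.inr hxE
  rw [Set.mem_preimage, SetClass.wrappingHull_mem_bracket, ν.points_subset_iff B.measurableSet]
  exact ⟨fun h => measure_mono_null (fun x hx => hx.2) h,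
    fun h => measure_mono_null hsub (measure_union_null h ν.2.1)⟩

theorem SetClass.measurable_wrappingHull (𝒜 : SetClass E) (hE : MeasurableSet E) :
    Measurable 𝒜.wrappingHull := by
  refine measurable_generateFrom ?_
  rintro _ ⟨B, rfl⟩
  rw [SetClass.wrappingHull_preimage_bracket]
  exact PointConfig.measurable_apply (hE.diff B.measurableSet) (measurableSet_singleton 0)

theorem SetClass.isPiSystem_range_bracket (𝒜 : SetClass E) :
    IsPiSystem (Set.range 𝒜.bracket) := by
  rintro _ ⟨A, rfl⟩ _ ⟨B, rfl⟩ -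
  refine ⟨⟨A.carrier ∩ B.carrier, ?_⟩, ?_⟩
  · rw [← Set.sInter_pair]
    exact 𝒜.sInter_mem _ (Set.pair_subset A.mem B.mem) (Set.insert_nonempty _ _)
  · ext D
    exact Set.subset_inter_iff

end Points

/-! ### Finite-dimensional laws and conditioning of Poisson processes -/

section Poisson

variable {d : ℕ} {E : Set (EuclideanSpace ℝ (Fin d))}

/-- Two finite measures on the space of configurations agree if they have the same
finite-dimensional distributions. -/
theorem PointConfig.measure_ext {μ μ' : Measure (PointConfig E)} [IsFiniteMeasure μ]
    (h : ∀ I : Finset {B : Set (EuclideanSpace ℝ (Fin d)) // MeasurableSet B},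
      μ.map (fun ν (B : I) => ν.1 B.1.1) = μ'.map (fun ν (B : I) => ν.1 B.1.1)) : μ = μ' := by
  let Φ : PointConfig E → {B : Set (EuclideanSpace ℝ (Fin d)) // MeasurableSet B} → ℝ≥0∞ :=
    fun ν B => ν.1 B.1
  have hΦ : Measurable Φ := measurable_pi_lambda _ fun B => PointConfig.measurable_apply B.2
  have hmap : μ.map Φ = μ'.map Φ := by
    refine IsProjectiveLimit.unique
      (P := fun I => μ.map (fun ν (B : I) => ν.1 B.1.1)) ?_ ?_
    · intro I
      rw [Measure.map_map (Finset.measurable_restrict I) hΦ]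
      rfl
    · intro I
      rw [Measure.map_map (Finset.measurable_restrict I) hΦ]
      exact (h I).symm
  -- The evaluations generate the σ-algebra, so equality of the image laws on the product space
  -- suffices.
  have hcomap : (inferInstance : MeasurableSpace (PointConfig E)) ≤
      MeasurableSpace.comap Φ MeasurableSpace.pi := by
    refine Measurable.comap_le (m₁ := MeasurableSpace.comap Φ MeasurableSpace.pi) ?_
    refine Measure.measurable_of_measurable_coe _ fun B hB => ?_
    exact (measurable_pi_apply (⟨B, hB⟩ : {B // MeasurableSet B})).comp (comap_measurable Φ)
  ext F hF
  obtain ⟨G, hG, rfl⟩ := hcomap F hF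
  rw [← Measure.map_apply hΦ hG, hmap, Measure.map_apply hΦ hG]

/-- The atom of the partition generated by the family `B` which lies in exactly those `B i` with
`i ∈ s`. -/
def partitionAtom {X ι : Type*} (B : ι → Set X) (s : Set ι) : Set X :=
  {x | {i | x ∈ B i} = s}

theorem pairwise_disjoint_partitionAtom {X ι : Type*} (B : ι → Set X) :
    Pairwise fun s t => Disjoint (partitionAtom B s) (partitionAtom B t) :=
  fun _ _ hst => Set.disjoint_left.2 fun _ hs ht => hst (hs.symm.trans ht)

theorem measurableSet_partitionAtom {X ι : Type*} [MeasurableSpace X] [Countable ι]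
    {B : ι → Set X} (hB : ∀ i, MeasurableSet (B i)) (s : Set ι) :
    MeasurableSet (partitionAtom B s) := by
  have : partitionAtom B s = ⋂ i, {x | x ∈ B i ↔ i ∈ s} := by
    ext x
    simp [partitionAtom, Set.ext_iff]
  rw [this]
  exact MeasurableSet.iInter fun i => (hB i).iff (MeasurableSet.const _)

open Classical in
theorem measure_eq_sum_partitionAtom {X ι : Type*} [MeasurableSpace X] [Fintype ι]
    {B : ι → Set X} (hB : ∀ i, MeasurableSet (B i)) (ν : Measure X) (i : ι) :
    ν (B i) = ∑ s ∈ Finset.univ.filter (fun s : Set ι => i ∈ s), ν (partitionAtom B s) := by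
  rw [← measure_biUnion_finset
    (fun s _ t _ hst => pairwise_disjoint_partitionAtom B hst)
    (fun s _ => measurableSet_partitionAtom hB s)]
  congr 1
  ext x
  simp [partitionAtom]

/-- Two finite measures on the space of configurations agree if they give the same joint law to the
numbers of points in disjoint sets. -/
theorem PointConfig.measure_ext_of_disjoint {μ μ' : Measure (PointConfig E)} [IsFiniteMeasure μ]
    (h : ∀ (ι : Type) [Fintype ι] (B : ι → Set (EuclideanSpace ℝ (Fin d))),
      (∀ i, MeasurableSet (B i)) → Pairwise (fun i j => Disjoint (B i) (B j)) →
      μ.map (fun ν i => ν.1 (B i)) = μ'.map (fun ν i => ν.1 (B i))) : μ = μ' := by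
  classical
  refine PointConfig.measure_ext fun I => ?_
  have hB : ∀ i : I, MeasurableSet i.1.1 := fun i => i.1.2
  let C : Fin (Fintype.card (Set I)) → Set (EuclideanSpace ℝ (Fin d)) :=
    fun k => partitionAtom (fun i : I => i.1.1) ((Fintype.equivFin (Set I)).symm k)
  have hC : ∀ k, MeasurableSet (C k) := fun k => measurableSet_partitionAtom hB _
  have key := h (Fin (Fintype.card (Set I))) C hC fun j k hjk =>
    pairwise_disjoint_partitionAtom _ fun heq => hjk ((Fintype.equivFin (Set I)).symm.injective heq)
  -- Each `B i` is the disjoint union of the atoms indexed by sets containing `i`, so its count is a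
  -- fixed sum of atom counts.
  let φ : (Fin (Fintype.card (Set I)) → ℝ≥0∞) → I → ℝ≥0∞ := fun y i =>
    ∑ s ∈ Finset.univ.filter (fun s : Set I => i ∈ s), y (Fintype.equivFin (Set I) s)
  have hφ : Measurable φ := by
    refine measurable_pi_lambda _ fun i => Finset.measurable_sum _ fun s _ => ?_
    exact measurable_pi_apply _
  have hX : Measurable fun (ν : PointConfig E) k => ν.1 (C k) :=
    measurable_pi_lambda _ fun k => PointConfig.measurable_apply (hC k)
  have hcomp : (fun (ν : PointConfig E) (i : I) => ν.1 i.1.1) =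
      φ ∘ fun (ν : PointConfig E) k => ν.1 (C k) := by
    funext ν i
    simp only [φ, C, Function.comp, Equiv.symm_apply_apply]
    exact measure_eq_sum_partitionAtom hB ν.1 i
  rw [hcomp, ← Measure.map_map hφ hX, ← Measure.map_map hφ hX, key]

variable {Ω : Type*} [MeasurableSpace Ω] {lam : ℝ≥0} {A : Set (EuclideanSpace ℝ (Fin d))}
  {N : Ω → PointConfig E} {μ : Measure Ω}

theorem IsPoissonPointProcess.measurable_apply (hN : IsPoissonPointProcess lam A N μ)
    {B : Set (EuclideanSpace ℝ (Fin d))} (hB : MeasurableSet B) :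
    Measurable fun ω => (N ω).1 B :=
  (PointConfig.measurable_apply hB).comp hN.measurable

theorem IsPoissonPointProcess.iIndepFun_fintype (hN : IsPoissonPointProcess lam A N μ)
    {ι : Type*} [Fintype ι] {B : ι → Set (EuclideanSpace ℝ (Fin d))}
    (hB : ∀ i, MeasurableSet (B i)) (hBE : ∀ i, B i ⊆ E)
    (hd : Pairwise fun i j => Disjoint (B i) (B j)) :
    ProbabilityTheory.iIndepFun (fun i ω => (N ω).1 (B i)) μ := by
  have h := (hN.iIndepFun _ (fun k => B ((Fintype.equivFin ι).symm k)) (fun _ => hB _)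
    (fun _ => hBE _) fun j k hjk => hd fun heq => hjk ((Fintype.equivFin ι).symm.injective heq))
  simpa using h.precomp (Fintype.equivFin ι).injective

/-- The probability that a Poisson point process has no points in a given set is positive. -/
theorem IsPoissonPointProcess.measure_apply_eq_zero (hN : IsPoissonPointProcess lam A N μ)
    {B : Set (EuclideanSpace ℝ (Fin d))} (hB : MeasurableSet B) (hBE : B ⊆ E) :
    μ {ω | (N ω).1 B = 0} =
      ENNReal.ofReal (Real.exp (-(lam * (volume (A ∩ B)).toNNReal : ℝ≥0))) := by
  have hm : Measurable (fun n : ℕ => (n : ℝ≥0∞)) := measurable_of_countable _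
  have hpre : (fun n : ℕ => (n : ℝ≥0∞)) ⁻¹' {0} = {0} := by
    ext n
    simp
  have h := (hN.hasLaw_poisson B hB hBE).map_eq
  have h0 := congrArg (fun ρ : Measure ℝ≥0∞ => ρ {0}) h
  rw [Measure.map_apply (hN.measurable_apply hB) (measurableSet_singleton 0),
    Measure.map_apply hm (measurableSet_singleton 0), hpre, poissonMeasure_singleton] at h0
  change μ ((fun ω => (N ω).1 B) ⁻¹' {0}) = _
  simpa using h0

theorem IsPoissonPointProcess.ae_apply_sdiff_eq_zero [IsProbabilityMeasure μ]
    (hN : IsPoissonPointProcess lam A N μ) (hE : MeasurableSet E) (hA : MeasurableSet A) :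
    ∀ᵐ ω ∂μ, (N ω).1 (E \ A) = 0 := by
  have hEA := hE.diff hA
  have h := hN.measure_apply_eq_zero hEA Set.sdiff_subset
  -- The Poisson parameter for `E \ A` is therefore `0`.
  have hempty : A ∩ (E \ A) = ∅ := Set.disjoint_sdiff_right.inter_eq
  rw [hempty] at h
  have hm : MeasurableSet {ω | (N ω).1 (E \ A) = 0} :=
    hN.measurable_apply hEA (measurableSet_singleton 0)
  exact (mem_ae_iff_prob_eq_one hm).2 (by simpa using h)

theorem PointConfig.apply_eq_apply_inter {ν : PointConfig E} (h : ν.1 (E \ A) = 0)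
    (B : Set (EuclideanSpace ℝ (Fin d))) : ν.1 B = ν.1 (B ∩ A) := by
  refine le_antisymm ?_ (measure_mono Set.inter_subset_left)
  have hsub : B ⊆ (B ∩ A) ∪ ((E \ A) ∪ Eᶜ) := fun x hx => by
    by_cases hxA : x ∈ A
    · exact Or.inl ⟨hx, hxA⟩
    · by_cases hxE : x ∈ E
      · exact Or.inr (Or.inl ⟨hxE, hxA⟩)
      · exact Or.inr (Or.inr hxE)
  refine (measure_mono hsub).trans ((measure_union_le _ _).trans ?_)
  rw [measure_union_null h ν.2.1, add_zero]

variable {Ω' : Type*} [MeasurableSpace Ω'] {N' : Ω' → PointConfig E} {μ' : Measure Ω'}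

/-- The joint law of the numbers of points of a Poisson point process in disjoint sets. -/
theorem IsPoissonPointProcess.map_apply_eq_pi [IsProbabilityMeasure μ]
    (hN : IsPoissonPointProcess lam A N μ) (hAE : A ⊆ E) {ι : Type*} [Fintype ι]
    {B : ι → Set (EuclideanSpace ℝ (Fin d))} (hB : ∀ i, MeasurableSet (B i)) (hBA : ∀ i, B i ⊆ A)
    (hd : Pairwise fun i j => Disjoint (B i) (B j)) :
    μ.map (fun ω i => (N ω).1 (B i)) = Measure.pi fun i =>
      (poissonMeasure (lam * (volume (B i)).toNNReal)).map (fun n : ℕ => (n : ℝ≥0∞)) := by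
  rw [(iIndepFun_iff_map_fun_eq_pi_map fun i => (hN.measurable_apply (hB i)).aemeasurable).1
    (hN.iIndepFun_fintype hB (fun i => (hBA i).trans hAE) hd)]
  congr 1
  funext i
  rw [(hN.hasLaw_poisson (B i) (hB i) ((hBA i).trans hAE)).map_eq,
    Set.inter_eq_self_of_subset_right (hBA i)]

theorem IsPoissonPointProcess.indepFun_apply (hN : IsPoissonPointProcess lam A N μ)
    {ι : Type*} [Fintype ι] {B : ι → Set (EuclideanSpace ℝ (Fin d))}
    (hB : ∀ i, MeasurableSet (B i)) (hBE : ∀ i, B i ⊆ E)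
    (hd : Pairwise fun i j => Disjoint (B i) (B j)) {C : Set (EuclideanSpace ℝ (Fin d))}
    (hC : MeasurableSet C) (hCE : C ⊆ E) (hBC : ∀ i, Disjoint (B i) C) :
    IndepFun (fun ω i => (N ω).1 (B i)) (fun ω => (N ω).1 C) μ := by
  classical
  -- Adjoining `C` as the index `none` lets joint independence be split into `none` against the
  -- rest.
  let D : Option ι → Set (EuclideanSpace ℝ (Fin d)) := fun o => o.elim C B
  have hD : ∀ o, MeasurableSet (D o) := by
    rintro (_ | i)
    exacts [hC, hB i]
  have hDE : ∀ o, D o ⊆ E := by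
    rintro (_ | i)
    exacts [hCE, hBE i]
  have hDd : Pairwise fun o p => Disjoint (D o) (D p) := by
    rintro (_ | i) (_ | j) hij
    · exact absurd rfl hij
    · exact (hBC j).symm
    · exact hBC i
    · exact hd fun h => hij (congrArg some h)
  have h := (hN.iIndepFun_fintype hD hDE hDd).indepFun_finset {none}ᶜ {none} disjoint_compl_left
    fun o => hN.measurable_apply (hD o)
  have hsome : ∀ i : ι, some i ∈ ({none}ᶜ : Finset (Option ι)) := by simp
  have hφ : Measurable fun (y : ({none}ᶜ : Finset (Option ι)) → ℝ≥0∞) (i : ι) =>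
      y ⟨some i, hsome i⟩ := measurable_pi_lambda _ fun i => measurable_pi_apply _
  have hψ : Measurable fun y : ({none} : Finset (Option ι)) → ℝ≥0∞ =>
      y ⟨none, Finset.mem_singleton_self _⟩ := measurable_pi_apply _
  exact h.comp hφ hψ

/-- Conditionally on having no points outside of `A`, a Poisson point process on `E` is a Poisson
point process on `A`. -/
theorem IsPoissonPointProcess.map_restrict [IsProbabilityMeasure μ] [IsProbabilityMeasure μ']
    (hE : MeasurableSet E) (hA : MeasurableSet A) (hAE : A ⊆ E)
    (hN : IsPoissonPointProcess lam E N μ) (hN' : IsPoissonPointProcess lam A N' μ') :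
    (μ.map N).restrict {ν | ν.1 (E \ A) = 0} =
      μ {ω | (N ω).1 (E \ A) = 0} • μ'.map N' := by
  have hEA := hE.diff hA
  have hDm : MeasurableSet {ν : PointConfig E | ν.1 (E \ A) = 0} :=
    PointConfig.measurable_apply hEA (measurableSet_singleton 0)
  have hprob := Measure.isProbabilityMeasure_map (μ := μ) hN.measurable.aemeasurable
  refine PointConfig.measure_ext_of_disjoint fun ι _ B hB hd => ?_
  have hBA : ∀ i, MeasurableSet (B i ∩ A) := fun i => (hB i).inter hA
  have hX : Measurable fun (ν : PointConfig E) i => ν.1 (B i ∩ A) :=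
    measurable_pi_lambda _ fun i => PointConfig.measurable_apply (hBA i)
  have hdA : Pairwise fun i j => Disjoint (B i ∩ A) (B j ∩ A) := fun i j hij =>
    (hd hij).mono Set.inter_subset_left Set.inter_subset_left
  have hcongr : ∀ ν : PointConfig E, ν.1 (E \ A) = 0 →
      (fun i => ν.1 (B i)) = fun i => ν.1 (B i ∩ A) := fun ν hν =>
    funext fun i => PointConfig.apply_eq_apply_inter hν (B i)
  have hae : ∀ᵐ ν ∂(μ'.map N'), ν.1 (E \ A) = 0 :=
    (ae_map_iff hN'.measurable.aemeasurable hDm).2 (hN'.ae_apply_sdiff_eq_zero hE hA)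
  rw [Measure.map_congr ((ae_restrict_iff' hDm).2 (Filter.Eventually.of_forall hcongr)),
    Measure.map_smul, Measure.map_congr (hae.mono hcongr), Measure.map_map hX hN'.measurable]
  -- Inside `A` both processes have the same intensity, so both sides are the same product of
  -- Poisson laws.
  have hlaw : μ'.map (fun ω i => (N' ω).1 (B i ∩ A)) = μ.map (fun ω i => (N ω).1 (B i ∩ A)) := by
    rw [hN'.map_apply_eq_pi hAE hBA (fun _ => Set.inter_subset_right) hdA,
      hN.map_apply_eq_pi subset_rfl hBA (fun _ => Set.inter_subset_right.trans hAE) hdA]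
  -- Counts inside `A` are independent of the void event outside, so restricting to that event only
  -- multiplies their law by its probability.
  have hind := hN.indepFun_apply hBA (fun _ => Set.inter_subset_right.trans hAE) hdA hEA
    Set.sdiff_subset fun _ => Set.disjoint_sdiff_right.mono_left Set.inter_subset_right
  ext G hG
  rw [Measure.map_apply hX hG, Measure.restrict_apply (hX hG),
    Measure.map_apply hN.measurable ((hX hG).inter hDm), Measure.smul_apply, smul_eq_mul]
  change _ = _ * μ'.map (fun ω i => (N' ω).1 (B i ∩ A)) G
  rw [hlaw, Measure.map_apply (measurable_pi_lambda _ fun i => hN.measurable_apply (hBA i)) hG,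
    mul_comm]
  exact hind.measure_inter_preimage_eq_mul G {0} hG (measurableSet_singleton 0)

end Poisson

end WrappingHull

/-! ### Assembly, with the law for the full window as dominating measure -/

theorem mainTheorem2 {d : ℕ} {E : Set (EuclideanSpace ℝ (Fin d))} (hEconv : Convex ℝ E)
    (hEcomp : IsCompact E) (𝒜 : WrappingHull.SetClass E) (lam : ℝ≥0) (hlam : 0 < lam)
    {Ω : Type*} [MeasurableSpace Ω] (N : Ω → WrappingHull.PointConfig E)
    (P : 𝒜.Elem → Measure Ω) (hprob : ∀ A, IsProbabilityMeasure (P A))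
    (hPPP : ∀ A : 𝒜.Elem, WrappingHull.IsPoissonPointProcess lam A.carrier N (P A)) :
    WrappingHull.IsSufficient (fun A : 𝒜.Elem => (P A).map N) 𝒜.wrappingHull ∧
      WrappingHull.IsComplete (fun A : 𝒜.Elem => (P A).map N) 𝒜.wrappingHull := by
  have hE := hEcomp.measurableSet
  have hS := 𝒜.measurable_wrappingHull hE
  let W : 𝒜.Elem := ⟨E, 𝒜.window_mem⟩
  have hW : WrappingHull.IsPoissonPointProcess lam E N (P W) := hPPP W
  have hfin : IsProbabilityMeasure ((P W).map N) :=
    Measure.isProbabilityMeasure_map hW.measurable.aemeasurable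
  let p : 𝒜.Elem → ℝ≥0∞ := fun A => P W {ω | (N ω).1 (E \ A.carrier) = 0}
  have hp0 : ∀ A, p A ≠ 0 := fun A => by
    change P W {ω | (N ω).1 (E \ A.carrier) = 0} ≠ 0
    rw [hW.measure_apply_eq_zero (hE.diff A.measurableSet) Set.sdiff_subset]
    exact (ENNReal.ofReal_pos.2 (Real.exp_pos _)).ne'
  have hp : ∀ A, p A ≠ ∞ := fun A => measure_ne_top _ _
  have hP : ∀ A, (P A).map N =
      (p A)⁻¹ • ((P W).map N).restrict (𝒜.wrappingHull ⁻¹' 𝒜.bracket A) := fun A => by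
    rw [WrappingHull.SetClass.wrappingHull_preimage_bracket,
      hW.map_restrict hE A.measurableSet (𝒜.subset_of_mem _ A.mem) (hPPP A), smul_smul,
      ENNReal.inv_mul_cancel (hp0 A) (hp A), one_smul]
  have hc : ∀ A, (p A)⁻¹ ≠ ∞ := fun A => ENNReal.inv_ne_top.2 (hp0 A)
  exact ⟨WrappingHull.isSufficient_of_eq_smul_restrict hS _ _ hc 𝒜.bracket
      (fun A => MeasurableSpace.measurableSet_generateFrom ⟨A, rfl⟩) hP,
    WrappingHull.isComplete_of_eq_smul_restrict hS _ _ hc (fun A => ENNReal.inv_ne_zero.2 (hp A))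
      𝒜.bracket rfl 𝒜.isPiSystem_range_bracket W
      (Set.eq_univ_of_forall fun A => 𝒜.subset_of_mem _ A.mem) hP⟩
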